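/- Consider a multi-server queue with $N$ job classes and $S$ servers. For each $i\in\{1,\dots,N\}$, class-$i$ jobs arrive according to an independent Poisson process of intensity $\lambda_i>0$ and can be processed by the servers of a set $\mathcal S_i\subset\{1,\dots,S\}$; the family $(\mathcal S_i)_i$ (the compatibility graph) is arbitrary. Server $s$ has capacity $\mu_s>0$, and job sizes are independent and exponentially distributed with mean $1$. Each server works on the earliest-arrived job present that it can process, several servers may work in parallel on the same job (their capacities add up), and a job leaves the queue when its service is complete. The state of the queue is the finite sequence $c=(c_1,\dots,c_n)$ of the classes of the jobs present, in order of arrival. It is a continuous-time Markov process on the set $\{1,\dots,N\}^*$ of finite sequences: from $c$, it jumps to $(c_1,\dots,c_n,i)$ at rate $\lambda_i$ for each class $i$, and the job in position $k$ is removed at rate $\sum_{s\in\mathcal S_{c_k}\setminus\bigcup_{\ell<k}\mathcal S_{c_\ell}}\mu_s$ for each $k=1,\dots,n$. For $A\subset\{1,\dots,N\}$, let $\mu(A)=\sum_{s\in\bigcup_{i\in A}\mathcal S_i}\mu_s$ be the total capacity of the servers compatible with at least one class of $A$. Then the queue is stable, in the sense that this Markov process is ergodic (it is irreducible and has a stationary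 probability distribution to which its law converges, as time tends to infinity, from every initial state), if and only if $$\sum_{i\in A}\lambda_i<\mu(A)\qquad\text{for every nonempty } A\subset\{1,\dots,N\}.$$ -/

import Mathlib

open scoped Topology

/-- A multi-server queue with `N` job classes and `S` servers: class-`i` jobs arrive according to
an independent Poisson process of intensity `arrivalRate i`, can be processed by the servers in
`servers i` (an arbitrary compatibility graph, possibly with isolated vertices), and server `s`
works at speed `capacity s`.  Job sizes are independent, exponential with mean `1`. -/
structure MultiServerQueue (N S : ℕ) where
  arrivalRate : Fin N → ℝ
  arrivalRate_pos : ∀ i, 0 < arrivalRate i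
  servers : Fin N → Finset (Fin S)
  capacity : Fin S → ℝ
  capacity_pos : ∀ s, 0 < capacity s

namespace MultiServerQueue

/-- A state of the queue: the finite sequence of the classes of the jobs present, in order of
arrival, starting from the head of the queue. -/
abbrev State (N : ℕ) : Type := List (Fin N)

variable {N S : ℕ}

/-- `μ(A)`: the total capacity of the servers compatible with at least one class in `A`. -/
def totalCapacity (Q : MultiServerQueue N S) (A : Finset (Fin N)) : ℝ :=
  ∑ s ∈ A.biUnion Q.servers, Q.capacity s

/-- The service rate of the job in position `k` (counted from `0`): each server works on the
first job of the queue that it can process, so the servers working on this job are those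
compatible with its class and with no class of an earlier job. -/
def serviceRate (Q : MultiServerQueue N S) (c : State N) (k : Fin c.length) : ℝ :=
  ∑ s ∈ Q.servers (c.get k) \ (c.take k).toFinset.biUnion Q.servers, Q.capacity s

/-- The infinitesimal generator of the queue, acting on functions of the state: an arrival of
class `i` appends `i` at the end of the sequence, at rate `arrivalRate i`; a service completion in
position `k` removes that position, at rate `serviceRate c k`. -/
noncomputable def generator (Q : MultiServerQueue N S) : Module.End ℝ (State N → ℝ) where
  toFun f c :=
    ∑ i : Fin N, Q.arrivalRate i * (f (c ++ [i]) - f c) +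
      ∑ k : Fin c.length, Q.serviceRate c k * (f (c.eraseIdx k) - f c)
  map_add' f g := by
    funext c
    simp only [Pi.add_apply]
    rw [add_add_add_comm, ← Finset.sum_add_distrib, ← Finset.sum_add_distrib]
    congr 1 <;> exact Finset.sum_congr rfl fun _ _ => by ring
  map_smul' a f := by
    funext c
    simp only [Pi.smul_apply, smul_eq_mul, RingHom.id_apply]
    rw [mul_add, Finset.mul_sum, Finset.mul_sum]
    congr 1 <;> exact Finset.sum_congr rfl fun _ _ => by ring

/-- The transition function of the Markov process on sequences of classes:
`transitionProb t c d` is the probability to be in state `d` at time `t` starting from `c` at time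
`0`.  Since the total jump rates are bounded, the transition semigroup is the exponential
`exp (t L)` of the generator `L`, and its `(c, d)` entry is the value at `c` of the (absolutely
convergent) exponential series applied to the indicator function of `d`. -/
noncomputable def transitionProb (Q : MultiServerQueue N S) (t : ℝ) (c d : State N) : ℝ :=
  ∑' n : ℕ, t ^ n / (n.factorial : ℝ) * ((Q.generator ^ n) (Pi.single d 1)) c

end MultiServerQueue

/-- A continuous-time Markov process on a countable set `E` with transition function `P` is
ergodic if it is irreducible and admits a stationary probability distribution to which its law
converges from every initial state (in other words, it is irreducible and positive recurrent). -/
def IsErgodicTransition {E : Type*} (P : ℝ → E → E → ℝ) : Prop :=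
  (∀ c d : E, ∃ t : ℝ, 0 ≤ t ∧ 0 < P t c d) ∧
  ∃ p : E → ℝ, (∀ d, 0 ≤ p d) ∧ HasSum p 1 ∧
    (∀ t : ℝ, 0 ≤ t → ∀ d, HasSum (fun c => p c * P t c d) (p d)) ∧
    ∀ c d : E, Filter.Tendsto (fun t : ℝ => P t c d) Filter.atTop (𝓝 (p d))

namespace MultiServerQueue

/-- The queue is stable if the Markov process of its state is ergodic. -/
def IsStable {N S : ℕ} (Q : MultiServerQueue N S) : Prop :=
  IsErgodicTransition Q.transitionProb

variable {N S : ℕ}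

lemma serviceRate_eq (Q : MultiServerQueue N S) (c : State N) (k : Fin c.length) :
    Q.serviceRate c k =
      Q.totalCapacity (c.take (k + 1)).toFinset - Q.totalCapacity (c.take k).toFinset := by
  unfold serviceRate totalCapacity
  have h : (c.take (k + 1)).toFinset = insert (c.get k) (c.take k).toFinset := by
    rw [List.take_succ_eq_append_getElem k.2, List.toFinset_append]
    ext; simp [or_comm]
  rw [h, Finset.biUnion_insert, eq_sub_iff_add_eq, ← Finset.sum_union Finset.sdiff_disjoint,
    Finset.sdiff_union_self_eq_union]

lemma abs_generator_le (Q : MultiServerQueue N S) (f : State N → ℝ) (M : ℝ)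
    (hf : ∀ c, |f c| ≤ M) (c : State N) :
    |Q.generator f c| ≤ (∑ i, Q.arrivalRate i + ∑ s, Q.capacity s) * 2 * M := by
  have hM : 0 ≤ M := (abs_nonneg _).trans (hf c)
  have hd : ∀ d, |f d - f c| ≤ 2 * M := fun d => by
    have := abs_sub (f d) (f c)
    linarith [hf d, hf c]
  have hs : ∀ k, 0 ≤ Q.serviceRate c k := fun k =>
    Finset.sum_nonneg fun s _ => (Q.capacity_pos s).le
  have hsum : ∑ k, Q.serviceRate c k ≤ ∑ s, Q.capacity s := by
    have h0 : ∑ k, Q.serviceRate c k = Q.totalCapacity c.toFinset := by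
      simp only [serviceRate_eq]
      rw [Fin.sum_univ_eq_sum_range (fun k => Q.totalCapacity (c.take (k + 1)).toFinset -
        Q.totalCapacity (c.take k).toFinset), Finset.sum_range_sub
        (fun k => Q.totalCapacity (c.take k).toFinset)]
      simp [totalCapacity]
    rw [h0]
    exact Finset.sum_le_sum_of_subset_of_nonneg (Finset.subset_univ _)
      fun s _ _ => (Q.capacity_pos s).le
  have h1 : |∑ i, Q.arrivalRate i * (f (c ++ [i]) - f c)| ≤ ∑ i, Q.arrivalRate i * (2 * M) := by
    refine (Finset.abs_sum_le_sum_abs _ _).trans (Finset.sum_le_sum fun i _ => ?_)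
    rw [abs_mul, abs_of_pos (Q.arrivalRate_pos i)]
    exact mul_le_mul_of_nonneg_left (hd _) (Q.arrivalRate_pos i).le
  have h2 : |∑ k : Fin c.length, Q.serviceRate c k * (f (c.eraseIdx k) - f c)| ≤
      ∑ k, Q.serviceRate c k * (2 * M) := by
    refine (Finset.abs_sum_le_sum_abs _ _).trans (Finset.sum_le_sum fun k _ => ?_)
    rw [abs_mul, abs_of_nonneg (hs k)]
    exact mul_le_mul_of_nonneg_left (hd _) (hs k)
  rw [← Finset.sum_mul] at h1 h2
  have h3 := mul_le_mul_of_nonneg_right hsum (by positivity : 0 ≤ 2 * M)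
  refine (abs_add_le _ _).trans ?_
  linarith

/-- The exponential series defining `transitionProb` converges. -/
lemma summable_transitionProb (Q : MultiServerQueue N S) (t : ℝ) (c d : State N) :
    Summable fun n : ℕ =>
      t ^ n / (n.factorial : ℝ) * ((Q.generator ^ n) (Pi.single d 1)) c := by
  set K := (∑ i, Q.arrivalRate i + ∑ s, Q.capacity s) * 2 with hK
  have hb : ∀ n : ℕ, ∀ c, |((Q.generator ^ n) (Pi.single d 1)) c| ≤ K ^ n := by
    intro n
    induction n with
    | zero =>
      intro c
      by_cases h : c = d <;> simp [h]
    | succ n ih =>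
      intro c
      rw [pow_succ', Module.End.mul_apply, pow_succ']
      exact Q.abs_generator_le _ _ ih c
  refine Summable.of_norm_bounded (Real.summable_pow_div_factorial (|t| * K)) fun n => ?_
  rw [Real.norm_eq_abs, abs_mul, abs_div, abs_pow, Nat.abs_cast, mul_pow, div_mul_eq_mul_div]
  gcongr
  exact hb n c

end MultiServerQueue

open Filter

/-! The jump rates are bounded, so the process is a discrete chain `jumpOperator` run at the times
of a Poisson process (`transitionProb_eq`). Stationarity in continuous time and invariance under one
jump are then equivalent (`poissonKernelOf_stationary`, `isInvariantFor_of_stationary`).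

Necessity: in equilibrium the number of jobs with class in `A` has mean drift zero
(`hasSum_mul_drift`). Its drift is at least the arrival rate of `A` minus the capacity of `A`. If
this difference were nonnegative, the drift would be nonnegative everywhere and strictly positive at
the empty state, which has positive mass.

Sufficiency: the product of the factors `arrivalRate i / totalCapacity A`, one per job, with `A` the
classes seen up to that job, is an invariant measure by partial balance (`sum_weight_insertIdx`).
Its total mass is finite because a recursion depending only on the set of classes present has a
finite supersolution (`exists_supersolution`, `summable_revWeight`). Convergence to the normalized
measure follows from compactness, uniqueness of the invariant distribution, and the fact that a
Poisson law of large mean is almost unchanged by a shift of one (`tendsto_poissonKernelOf`). -/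

theorem HasSum.of_eq {ι : Type*} {f g : ι → ℝ} {a b : ℝ} (h : HasSum f a)
    (hf : ∀ i, g i = f i) (hab : b = a) : HasSum g b := by
  rw [hab, funext hf]
  exact h

/-- Tonelli's theorem for series, the tool behind the exchanges of sums over states and over numbers
of jumps. -/
theorem hasSum_tsum_of_nonneg {ι κ : Type*} {u : ι → κ → ℝ} (h0 : ∀ i k, 0 ≤ u i k)
    {r : ι → ℝ} (h : ∀ i, HasSum (u i) (r i)) {R : ℝ} (hr : HasSum r R) :
    (∀ k, Summable fun i => u i k) ∧ HasSum (fun k => ∑' i, u i k) R := by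
  have hs : Summable (Function.uncurry u) := by
    refine (summable_prod_of_nonneg fun x => h0 x.1 x.2).2 ⟨fun i => (h i).summable, ?_⟩
    simpa only [Function.uncurry, fun i => (h i).tsum_eq] using hr.summable
  have hR : HasSum (Function.uncurry u) R := by
    have := hs.hasSum.prod_fiberwise (fun i => h i)
    rw [← this.unique hr]
    exact hs.hasSum
  have hsw : HasSum (fun x : κ × ι => u x.2 x.1) R :=
    (Equiv.prodComm κ ι).hasSum_iff.2 hR
  have hk : ∀ k, Summable fun i => u i k := fun k => hsw.summable.prod_factor k
  exact ⟨hk, hsw.prod_fiberwise fun k => (hk k).hasSum⟩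

/-! ### Markov operators and invariant measures -/

/-- A stochastic matrix with finitely supported rows, seen as an operator on functions. -/
structure IsMarkovOperator {E : Type*} (T : Module.End ℝ (E → ℝ)) : Prop where
  nonneg : ∀ f : E → ℝ, 0 ≤ f → 0 ≤ T f
  map_one : T 1 = 1
  exists_finset : ∀ c, ∃ s : Finset E, ∀ f : E → ℝ, (∀ e ∈ s, f e = 0) → T f c = 0

/-- `v` is an invariant measure of the operator `T`. -/
def IsInvariantFor {E : Type*} [DecidableEq E] (T : Module.End ℝ (E → ℝ)) (v : E → ℝ) : Prop :=
  ∀ d, HasSum (fun c => v c * T (Pi.single d 1) c) (v d)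

namespace IsMarkovOperator

variable {E : Type*} {T : Module.End ℝ (E → ℝ)}

theorem monotone (hT : IsMarkovOperator T) {f g : E → ℝ} (h : f ≤ g) : T f ≤ T g := by
  have := hT.nonneg (g - f) (sub_nonneg.2 h)
  rw [map_sub] at this
  exact sub_nonneg.1 this

theorem pow (hT : IsMarkovOperator T) (n : ℕ) : IsMarkovOperator (T ^ n) := by
  induction n with
  | zero =>
    exact ⟨fun f hf => by simpa using hf, by simp, fun c => ⟨{c}, fun f hf => by simpa using hf⟩⟩
  | succ n ih =>
    refine ⟨fun f hf => ?_, ?_, fun c => ?_⟩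
    · rw [pow_succ, Module.End.mul_apply]
      exact ih.nonneg _ (hT.nonneg _ hf)
    · rw [pow_succ, Module.End.mul_apply, hT.map_one, ih.map_one]
    · classical
      obtain ⟨s, hs⟩ := ih.exists_finset c
      choose g hg using hT.exists_finset
      refine ⟨s.biUnion g, fun f hf => ?_⟩
      rw [pow_succ, Module.End.mul_apply]
      exact hs _ fun e he => hg e f fun e' he' => hf e' (Finset.mem_biUnion.2 ⟨e, he, he'⟩)

variable [DecidableEq E]

theorem single_nonneg (hT : IsMarkovOperator T) (c d : E) : 0 ≤ T (Pi.single d 1) c :=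
  hT.nonneg _ (Pi.single_nonneg.2 zero_le_one) c

theorem single_le_one (hT : IsMarkovOperator T) (c d : E) : T (Pi.single d 1) c ≤ 1 := by
  have h : (Pi.single d 1 : E → ℝ) ≤ 1 := fun e => by
    by_cases h : e = d
    · subst h; simp
    · simp [h]
  simpa [hT.map_one] using hT.monotone h c

/-- Subtracting from `f` its values on the finite support of row `c` leaves a function that `T`
kills at `c`. Hence `T` acts as its matrix, even on unbounded functions. -/
theorem hasSum_single_mul (hT : IsMarkovOperator T) (f : E → ℝ) (c : E) :
    HasSum (fun e => T (Pi.single e 1) c * f e) (T f c) := by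
  obtain ⟨s, hs⟩ := hT.exists_finset c
  have h1 : T f c = ∑ e ∈ s, T (Pi.single e 1) c * f e := by
    have h2 : T (f - ∑ e ∈ s, f e • Pi.single e 1) c = 0 := by
      refine hs _ fun e he => ?_
      simp [Finset.sum_apply, Pi.single_apply, he]
    rw [map_sub, map_sum, Pi.sub_apply, Finset.sum_apply, sub_eq_zero] at h2
    rw [h2]
    refine Finset.sum_congr rfl fun e _ => ?_
    rw [map_smul, Pi.smul_apply, smul_eq_mul, mul_comm]
  rw [h1]
  refine hasSum_sum_of_ne_finset_zero fun e he => ?_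
  rw [hs, zero_mul]
  intro e' he'
  rw [Pi.single_eq_of_ne]
  rintro rfl
  exact he he'

theorem hasSum_apply_single (hT : IsMarkovOperator T) (c : E) :
    HasSum (fun e => T (Pi.single e 1) c) 1 := by
  simpa [hT.map_one] using hT.hasSum_single_mul 1 c

theorem hasSum_mul_apply (hT : IsMarkovOperator T) {v : E → ℝ} (hv : ∀ c, 0 ≤ v c)
    (hinv : IsInvariantFor T v) {f : E → ℝ} (hf : ∀ c, 0 ≤ f c) {R : ℝ}
    (hR : HasSum (fun c => v c * f c) R) : HasSum (fun c => v c * T f c) R := by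
  have h := (hasSum_tsum_of_nonneg (u := fun e c => v c * T (Pi.single e 1) c * f e)
    (fun e c => mul_nonneg (mul_nonneg (hv c) (hT.single_nonneg c e)) (hf e))
    (fun e => (hinv e).mul_right (f e)) hR).2
  have hc : ∀ c, ∑' e, v c * T (Pi.single e 1) c * f e = v c * T f c := fun c => by
    simpa only [mul_assoc] using ((hT.hasSum_single_mul f c).mul_left (v c)).tsum_eq
  simpa only [hc] using h

theorem isInvariantFor_pow (hT : IsMarkovOperator T) {v : E → ℝ} (hv : ∀ c, 0 ≤ v c)
    (hinv : IsInvariantFor T v) (n : ℕ) : IsInvariantFor (T ^ n) v := by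
  intro d
  induction n with
  | zero =>
    have : (fun c => v c * ((T ^ 0) (Pi.single d 1 : E → ℝ)) c) =
        fun c => if c = d then v d else 0 := by
      funext c
      by_cases h : c = d
      · subst h; simp
      · simp [h]
    rw [this]
    exact hasSum_ite_eq d (v d)
  | succ n ih =>
    simp only [pow_succ', Module.End.mul_apply]
    exact hT.hasSum_mul_apply hv hinv (fun c => (hT.pow n).single_nonneg c d) ih

theorem mul_pow_le (hT : IsMarkovOperator T) {v : E → ℝ} (hv : ∀ c, 0 ≤ v c)
    (hinv : IsInvariantFor T v) (n : ℕ) (c d : E) : v c * (T ^ n) (Pi.single d 1) c ≤ v d :=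
  le_hasSum (hT.isInvariantFor_pow hv hinv n d) c
    fun e _ => mul_nonneg (hv e) ((hT.pow n).single_nonneg e d)

/-- Uniqueness of the invariant probability distribution of an irreducible Markov operator. -/
theorem invariant_unique (hT : IsMarkovOperator T)
    (hirr : ∀ c d, ∃ n : ℕ, 0 < (T ^ n) (Pi.single d 1) c) {p q : E → ℝ}
    (hp : HasSum p 1) (hpi : IsInvariantFor T p)
    (hq : HasSum q 1) (hqi : IsInvariantFor T q) : q = p := by
  -- The positive part of `q - p` is subinvariant (`hle`), and `T` preserves total mass, so it is
  -- invariant.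
  set v : E → ℝ := fun c => max (q c - p c) 0 with hv
  have hv0 : ∀ c, 0 ≤ v c := fun c => le_max_right _ _
  have hvs : Summable v :=
    Summable.of_nonneg_of_le hv0 (fun c => max_le (le_abs_self _) (abs_nonneg _))
      (hq.summable.sub hp.summable).abs
  obtain ⟨hs, hw⟩ := hasSum_tsum_of_nonneg (u := fun c d => v c * T (Pi.single d 1) c)
    (fun c d => mul_nonneg (hv0 c) (hT.single_nonneg c d))
    (fun c => by simpa using (hT.hasSum_apply_single c).mul_left (v c)) hvs.hasSum
  have hle : ∀ d, v d ≤ ∑' c, v c * T (Pi.single d 1) c := by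
    intro d
    refine max_le ?_ (tsum_nonneg fun c => mul_nonneg (hv0 c) (hT.single_nonneg c d))
    refine hasSum_le (fun c => ?_) ((hqi d).sub (hpi d)) (hs d).hasSum
    rw [← sub_mul]
    exact mul_le_mul_of_nonneg_right (le_max_left _ _) (hT.single_nonneg c d)
  have hinv : IsInvariantFor T v := by
    intro d
    have : v d = ∑' c, v c * T (Pi.single d 1) c := by
      by_contra hne
      exact lt_irrefl _ (hasSum_lt hle (lt_of_le_of_ne (hle d) hne) hvs.hasSum hw)
    have h2 := (hs d).hasSum
    rwa [← this] at h2
  -- If `v` charges one state, irreducibility makes it charge all of them; then `p < q` everywhere,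
  -- although both have mass one.
  have hqp : ∀ c, q c ≤ p c := by
    intro c
    by_contra! hc
    have hpos : 0 < v c := lt_max_of_lt_left (sub_pos.2 hc)
    have hall : ∀ d, p d < q d := by
      intro d
      obtain ⟨n, hn⟩ := hirr c d
      have h := (mul_pos hpos hn).trans_le (hT.mul_pow_le hv0 hinv n c d)
      rcases lt_max_iff.1 h with h | h
      · linarith
      · exact absurd h (lt_irrefl _)
    exact lt_irrefl _ (hasSum_lt (fun d => (hall d).le) (hall c) hp hq)
  funext c
  by_contra hne
  exact lt_irrefl _ (hasSum_lt hqp (lt_of_le_of_ne (hqp c) hne) hq hp)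

end IsMarkovOperator

/-! ### Poisson weights -/

/-- The probability that a Poisson random variable of mean `x` equals `n`. -/
noncomputable def poissonWeight (x : ℝ) (n : ℕ) : ℝ :=
  Real.exp (-x) * (x ^ n / (n.factorial : ℝ))

theorem poissonWeight_nonneg {x : ℝ} (hx : 0 ≤ x) (n : ℕ) : 0 ≤ poissonWeight x n := by
  unfold poissonWeight; positivity

theorem poissonWeight_pos {x : ℝ} (hx : 0 < x) (n : ℕ) : 0 < poissonWeight x n := by
  unfold poissonWeight; positivity

theorem hasSum_pow_div_factorial (x : ℝ) :
    HasSum (fun n : ℕ => x ^ n / (n.factorial : ℝ)) (Real.exp x) := by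
  rw [Real.exp_eq_exp_ℝ]
  exact NormedSpace.expSeries_div_hasSum_exp x

theorem hasSum_poissonWeight (x : ℝ) : HasSum (poissonWeight x) 1 := by
  have := (hasSum_pow_div_factorial x).mul_left (Real.exp (-x))
  rwa [← Real.exp_add, neg_add_cancel, Real.exp_zero] at this

theorem poissonWeight_succ_mul (x : ℝ) (n : ℕ) :
    poissonWeight x (n + 1) * (n + 1) = x * poissonWeight x n := by
  have : (n.factorial : ℝ) ≠ 0 := by positivity
  have : (n : ℝ) + 1 ≠ 0 := by positivity
  unfold poissonWeight
  rw [Nat.factorial_succ]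
  push_cast
  field_simp
  ring

/-- The Stein–Chen identity `E[X m(X)] = x E[m(X + 1)]`. -/
theorem hasSum_poissonWeight_mul_succ {x : ℝ} {m : ℕ → ℝ} {b : ℝ}
    (h : HasSum (fun n => poissonWeight x n * m (n + 1)) b) :
    HasSum (fun n : ℕ => poissonWeight x n * (n * m n)) (x * b) := by
  rw [← hasSum_nat_add_iff' 1]
  simp only [Finset.range_one, Finset.sum_singleton, Nat.cast_zero, zero_mul, mul_zero, sub_zero]
  refine (h.mul_left x).of_eq (fun n => ?_) rfl
  have := poissonWeight_succ_mul x n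
  push_cast
  rw [← mul_assoc, ← mul_assoc, this]

theorem hasSum_poissonWeight_sq (x : ℝ) :
    HasSum (fun n : ℕ => poissonWeight x n * ((n - x) ^ 2)) x := by
  have h0 := hasSum_poissonWeight x
  have h1 : HasSum (fun n : ℕ => poissonWeight x n * (n * 1)) (x * 1) :=
    hasSum_poissonWeight_mul_succ (m := fun _ => 1) (by simpa using h0)
  have h2 : HasSum (fun n : ℕ => poissonWeight x n * (n * n)) (x * (x + 1)) :=
    hasSum_poissonWeight_mul_succ (m := fun n => n) (by
      have := h1.add h0
      simp only [mul_one] at this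
      convert this using 2 with n
      push_cast; ring)
  exact ((h2.sub (h1.mul_left (2 * x))).add (h0.mul_left (x ^ 2))).of_eq (fun n => by ring)
    (by ring)

/-- The total variation distance between the Poisson distribution and its shift by one tends to
zero as the mean tends to infinity. -/
theorem sqrt_mul_abs_poisson_shift_le {x : ℝ} (hx : 0 < x) {m : ℕ → ℝ} (hm : ∀ n, |m n| ≤ 1)
    {a b : ℝ} (ha : HasSum (fun n => poissonWeight x n * m n) a)
    (hb : HasSum (fun n => poissonWeight x n * m (n + 1)) b) : √x * |b - a| ≤ 1 := by
  have h1 : HasSum (fun n : ℕ => poissonWeight x n * ((n - x) * m n)) (x * (b - a)) :=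
    ((hasSum_poissonWeight_mul_succ hb).sub (ha.mul_left x)).of_eq (fun n => by ring) (by ring)
  have hs : 0 < √x := Real.sqrt_pos.2 hx
  have hsq : √x * √x = x := Real.mul_self_sqrt hx.le
  -- By the identity above, `x * (b - a)` is at most `E|X - x|` in absolute value. The bound `|y| ≤
  -- √x / 2 + y ^ 2 / (2 * √x)` and the variance `x` replace Cauchy–Schwarz.
  have h2 := ((hasSum_poissonWeight x).mul_left (√x / 2)).add
    ((hasSum_poissonWeight_sq x).mul_left (1 / (2 * √x)))
  have hval : √x / 2 * 1 + 1 / (2 * √x) * x = √x := by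
    field_simp
    nlinarith
  rw [hval] at h2
  have h3 : ∀ n : ℕ, |poissonWeight x n * ((n - x) * m n)| ≤
      √x / 2 * poissonWeight x n + 1 / (2 * √x) * (poissonWeight x n * (n - x) ^ 2) := by
    intro n
    rw [abs_mul, abs_mul, abs_of_nonneg (poissonWeight_nonneg hx.le n)]
    have h4 : |(n : ℝ) - x| * |m n| ≤ √x / 2 + 1 / (2 * √x) * (n - x) ^ 2 := by
      refine (mul_le_of_le_one_right (abs_nonneg _) (hm n)).trans ?_
      have h5 : √x / 2 + 1 / (2 * √x) * (n - x) ^ 2 - |(n : ℝ) - x| =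
          (√x - |(n : ℝ) - x|) ^ 2 / (2 * √x) := by
        rw [← sq_abs ((n : ℝ) - x)]
        field_simp
        ring
      have : 0 ≤ (√x - |(n : ℝ) - x|) ^ 2 / (2 * √x) := by positivity
      linarith
    calc _ ≤ poissonWeight x n * (√x / 2 + 1 / (2 * √x) * (n - x) ^ 2) :=
          mul_le_mul_of_nonneg_left h4 (poissonWeight_nonneg hx.le n)
      _ = _ := by ring
  have h6 : |x * (b - a)| ≤ √x :=
    abs_le.2 ⟨hasSum_le (fun n => (abs_le.1 (h3 n)).1) h2.neg h1,
      hasSum_le (fun n => (abs_le.1 (h3 n)).2) h1 h2⟩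
  rw [abs_mul, abs_of_pos hx] at h6
  refine le_of_mul_le_mul_left ?_ hs
  rw [← mul_assoc, hsq, mul_one]
  exact h6

theorem summable_poissonWeight_mul (x : ℝ) {m : ℕ → ℝ} (hm : ∀ n, |m n| ≤ 1) :
    Summable fun n => poissonWeight x n * m n := by
  refine Summable.of_norm_bounded (hasSum_poissonWeight x).summable.abs fun n => ?_
  rw [Real.norm_eq_abs, abs_mul]
  exact mul_le_of_le_one_right (abs_nonneg _) (hm n)

/-! ### The uniformized continuous-time chain -/

namespace IsMarkovOperator

variable {E : Type*} {T : Module.End ℝ (E → ℝ)}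

theorem apply_le_one (hT : IsMarkovOperator T) {f : E → ℝ} (hf : ∀ e, f e ≤ 1) (c : E) :
    T f c ≤ 1 := by
  simpa [hT.map_one] using hT.monotone (g := 1) hf c

theorem abs_pow_apply_le (hT : IsMarkovOperator T) {f : E → ℝ} (h0 : ∀ e, 0 ≤ f e)
    (h1 : ∀ e, f e ≤ 1) (c : E) (n : ℕ) : |(T ^ n) f c| ≤ 1 := by
  rw [abs_of_nonneg ((hT.pow n).nonneg f h0 c)]
  exact (hT.pow n).apply_le_one h1 c

variable [DecidableEq E]

/-- The transition function of the continuous-time Markov chain that jumps according to `T` at the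
times of a Poisson process of rate `1`. -/
noncomputable def _root_.poissonKernelOf (T : Module.End ℝ (E → ℝ)) (x : ℝ) (c d : E) : ℝ :=
  ∑' n : ℕ, poissonWeight x n * (T ^ n) (Pi.single d 1) c

theorem abs_pow_single_le (hT : IsMarkovOperator T) (c d : E) (n : ℕ) :
    |(T ^ n) (Pi.single d 1) c| ≤ 1 := by
  rw [abs_of_nonneg ((hT.pow n).single_nonneg c d)]
  exact (hT.pow n).single_le_one c d

theorem hasSum_poissonKernelOf (hT : IsMarkovOperator T) (x : ℝ) (c d : E) :
    HasSum (fun n => poissonWeight x n * (T ^ n) (Pi.single d 1) c) (poissonKernelOf T x c d) :=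
  (summable_poissonWeight_mul x (hT.abs_pow_single_le c d)).hasSum

theorem poissonKernelOf_nonneg (hT : IsMarkovOperator T) {x : ℝ} (hx : 0 ≤ x) (c d : E) :
    0 ≤ poissonKernelOf T x c d :=
  tsum_nonneg fun n => mul_nonneg (poissonWeight_nonneg hx n) ((hT.pow n).single_nonneg c d)

theorem poissonKernelOf_pos (hT : IsMarkovOperator T) {x : ℝ} (hx : 0 < x) {c d : E} {n : ℕ}
    (h : 0 < (T ^ n) (Pi.single d 1) c) : 0 < poissonKernelOf T x c d :=
  (mul_pos (poissonWeight_pos hx n) h).trans_le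
    (le_hasSum (hT.hasSum_poissonKernelOf x c d) n fun k _ =>
      mul_nonneg (poissonWeight_nonneg hx.le k) ((hT.pow k).single_nonneg c d))

theorem hasSum_poissonKernelOf_mul (hT : IsMarkovOperator T) {x : ℝ} (hx : 0 ≤ x) {f : E → ℝ}
    (h0 : ∀ e, 0 ≤ f e) (h1 : ∀ e, f e ≤ 1) (c : E) :
    HasSum (fun e => poissonKernelOf T x c e * f e) (∑' n, poissonWeight x n * (T ^ n) f c) := by
  have h := (hasSum_tsum_of_nonneg
    (u := fun n e => poissonWeight x n * (T ^ n) (Pi.single e 1) c * f e)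
    (fun n e => mul_nonneg (mul_nonneg (poissonWeight_nonneg hx n)
      ((hT.pow n).single_nonneg c e)) (h0 e))
    (fun n => by simpa only [mul_assoc] using
      ((hT.pow n).hasSum_single_mul f c).mul_left (poissonWeight x n))
    (summable_poissonWeight_mul x (hT.abs_pow_apply_le h0 h1 c)).hasSum).2
  simpa only [fun e => ((hT.hasSum_poissonKernelOf x c e).mul_right (f e)).tsum_eq] using h

theorem hasSum_poissonKernelOf_one (hT : IsMarkovOperator T) {x : ℝ} (hx : 0 ≤ x) (c : E) :
    HasSum (fun e => poissonKernelOf T x c e) 1 := by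
  have h := hT.hasSum_poissonKernelOf_mul hx (f := 1) (fun _ => zero_le_one) (fun _ => le_rfl) c
  simpa [(hT.pow _).map_one, (hasSum_poissonWeight x).tsum_eq] using h

/-- Invariance of `p` is not assumed, so that this also serves to deduce invariance from
stationarity. -/
theorem hasSum_mul_poissonKernelOf (hT : IsMarkovOperator T) {p : E → ℝ} (hp : ∀ c, 0 ≤ p c)
    {x : ℝ} (hx : 0 ≤ x) {d : E} {m : ℕ → ℝ}
    (hm : ∀ n, HasSum (fun c => p c * (T ^ n) (Pi.single d 1) c) (m n)) {R : ℝ}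
    (hR : HasSum (fun n => poissonWeight x n * m n) R) :
    HasSum (fun c => p c * poissonKernelOf T x c d) R := by
  have h := (hasSum_tsum_of_nonneg
    (u := fun n c => poissonWeight x n * (p c * (T ^ n) (Pi.single d 1) c))
    (fun n c => mul_nonneg (poissonWeight_nonneg hx n)
      (mul_nonneg (hp c) ((hT.pow n).single_nonneg c d)))
    (fun n => (hm n).mul_left (poissonWeight x n)) hR).2
  have hc : ∀ c, ∑' n, poissonWeight x n * (p c * (T ^ n) (Pi.single d 1) c) =
      p c * poissonKernelOf T x c d := fun c => by
    simpa only [mul_left_comm] using ((hT.hasSum_poissonKernelOf x c d).mul_left (p c)).tsum_eq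
  simpa only [hc] using h

theorem poissonKernelOf_stationary (hT : IsMarkovOperator T) {p : E → ℝ} (hp : ∀ c, 0 ≤ p c)
    (hpi : IsInvariantFor T p) {x : ℝ} (hx : 0 ≤ x) (d : E) :
    HasSum (fun c => p c * poissonKernelOf T x c d) (p d) :=
  hT.hasSum_mul_poissonKernelOf hp hx (fun n => hT.isInvariantFor_pow hp hpi n d)
    (by simpa using (hasSum_poissonWeight x).mul_right (p d))

/-- One extra jump shifts the Poisson number of jumps by one, so the law at time `x` is invariant up
to `1 / √x`. -/
theorem sqrt_mul_abs_poissonKernelOf_shift_le (hT : IsMarkovOperator T) {x : ℝ} (hx : 0 < x)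
    (c d : E) :
    √x * |(∑' e, poissonKernelOf T x c e * T (Pi.single d 1) e) - poissonKernelOf T x c d| ≤ 1 := by
  rw [(hT.hasSum_poissonKernelOf_mul hx.le (fun e => hT.single_nonneg e d)
    (fun e => hT.single_le_one e d) c).tsum_eq]
  refine sqrt_mul_abs_poisson_shift_le hx (hT.abs_pow_single_le c d)
    (hT.hasSum_poissonKernelOf x c d) ?_
  have := (summable_poissonWeight_mul x (m := fun n => (T ^ (n + 1)) (Pi.single d 1) c)
    fun n => hT.abs_pow_single_le c d (n + 1)).hasSum
  simpa only [pow_succ, Module.End.mul_apply] using this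

/-- Convergence to equilibrium of an irreducible positive recurrent uniformized chain. -/
theorem tendsto_poissonKernelOf (hT : IsMarkovOperator T)
    (hirr : ∀ c d, ∃ n : ℕ, 0 < (T ^ n) (Pi.single d 1) c) {p : E → ℝ} (hp0 : ∀ c, 0 < p c)
    (hp : HasSum p 1) (hpi : IsInvariantFor T p) (c d : E) :
    Tendsto (fun x => poissonKernelOf T x c d) atTop (𝓝 (p d)) := by
  suffices h : Tendsto (fun x => poissonKernelOf T x c) atTop (𝓝 p) from
    (tendsto_pi_nhds.1 h) d
  -- A single term of the stationarity sum. This summable bound gives both compactness and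
  -- domination, hence no loss of mass in the limit.
  have hbound : ∀ x, 0 ≤ x → ∀ e, poissonKernelOf T x c e ≤ p e / p c := fun x hx e => by
    rw [le_div_iff₀' (hp0 c)]
    exact le_hasSum (hT.poissonKernelOf_stationary (fun c => (hp0 c).le) hpi hx e) c
      fun e' _ => mul_nonneg (hp0 e').le (hT.poissonKernelOf_nonneg hx e' e)
  have hcomp : IsCompact (Set.univ.pi fun e => Set.Icc (0 : ℝ) (p e / p c)) :=
    isCompact_univ_pi fun e => isCompact_Icc
  refine hcomp.tendsto_nhds_of_unique_mapClusterPt ?_ fun q _ hq => ?_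
  · filter_upwards [eventually_ge_atTop 0] with x hx e _
    exact ⟨hT.poissonKernelOf_nonneg hx c e, hbound x hx e⟩
  -- Along an ultrafilter the cluster point becomes a limit, and dominated convergence of series
  -- holds along any filter.
  obtain ⟨U, hU, hUq⟩ := mapClusterPt_iff_ultrafilter.1 hq
  have hUe := tendsto_pi_nhds.1 hUq
  have hev : ∀ᶠ x in (U : Filter ℝ), 0 < x := hU (eventually_gt_atTop 0)
  have hnorm : ∀ᶠ x in (U : Filter ℝ), ∀ e, ‖poissonKernelOf T x c e‖ ≤ p e / p c := by
    filter_upwards [hev] with x hx e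
    rw [Real.norm_of_nonneg (hT.poissonKernelOf_nonneg hx.le c e)]
    exact hbound x hx.le e
  have hq0 : ∀ e, 0 ≤ q e := fun e => ge_of_tendsto (hUe e) <| by
    filter_upwards [hev] with x hx using hT.poissonKernelOf_nonneg hx.le c e
  have hqle : ∀ e, q e ≤ p e / p c := fun e => le_of_tendsto (hUe e) <| by
    filter_upwards [hev] with x hx using hbound x hx.le e
  have hqs : Summable q := Summable.of_nonneg_of_le hq0 hqle (hp.summable.div_const _)
  refine hT.invariant_unique hirr hp hpi ?_ fun d => ?_
  · have h1 := tendsto_tsum_of_dominated_convergence (hp.summable.div_const (p c)) hUe hnorm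
    have h2 : Tendsto (fun x => ∑' e, poissonKernelOf T x c e) (U : Filter ℝ) (𝓝 1) := by
      refine tendsto_const_nhds.congr' ?_
      filter_upwards [hev] with x hx using (hT.hasSum_poissonKernelOf_one hx.le c).tsum_eq.symm
    rw [← tendsto_nhds_unique h1 h2]
    exact hqs.hasSum
  · have hs : Summable fun e => q e * T (Pi.single d 1) e :=
      Summable.of_nonneg_of_le (fun e => mul_nonneg (hq0 e) (hT.single_nonneg e d))
        (fun e => mul_le_of_le_one_right (hq0 e) (hT.single_le_one e d)) hqs
    have h1 := tendsto_tsum_of_dominated_convergence (hp.summable.div_const (p c))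
      (fun e => (hUe e).mul_const (T (Pi.single d 1) e)) <| by
        filter_upwards [hnorm] with x hx e
        rw [norm_mul, Real.norm_of_nonneg (hT.single_nonneg e d)]
        exact (mul_le_of_le_one_right (norm_nonneg _) (hT.single_le_one e d)).trans (hx e)
    have h2 := (h1.sub (hUe d)).abs
    have h3 : Tendsto (fun x : ℝ => (√x)⁻¹) (U : Filter ℝ) (𝓝 0) :=
      (tendsto_inv_atTop_zero.comp Real.tendsto_sqrt_atTop).mono_left hU
    have h4 : |(∑' e, q e * T (Pi.single d 1) e) - q d| ≤ 0 := by
      refine le_of_tendsto_of_tendsto h2 h3 ?_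
      filter_upwards [hev] with x hx
      rw [← one_div, le_div_iff₀' (Real.sqrt_pos.2 hx)]
      exact hT.sqrt_mul_abs_poissonKernelOf_shift_le hx c d
    have h5 := sub_eq_zero.1 (abs_nonpos_iff.1 h4)
    rw [← h5]
    exact hs.hasSum

/-- Uniformization: the exponential of `κ (T - 1)` is the Poisson mixture of the powers of `T`. -/
theorem tsum_pow_smul_sub_one (hT : IsMarkovOperator T) (κ t : ℝ) (c d : E) :
    ∑' n : ℕ, t ^ n / (n.factorial : ℝ) * (((κ • (T - 1)) ^ n) (Pi.single d 1)) c =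
      poissonKernelOf T (κ * t) c d := by
  set x := κ * t with hx
  set τ : ℕ → ℝ := fun n => (T ^ n) (Pi.single d 1) c with hτ
  have hA : Summable fun n : ℕ => ‖(-x) ^ n / (n.factorial : ℝ)‖ :=
    (hasSum_pow_div_factorial (-x)).summable.norm
  have hB : Summable fun n : ℕ => ‖x ^ n / (n.factorial : ℝ) * τ n‖ := by
    refine Summable.of_nonneg_of_le (fun n => norm_nonneg _) (fun n => ?_)
      (hasSum_pow_div_factorial x).summable.norm
    rw [norm_mul]
    exact mul_le_of_le_one_right (norm_nonneg _) (hT.abs_pow_single_le c d n)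
  -- The factorization of the exponential is proved on each matrix entry, as a Cauchy product of
  -- scalar series matched with the binomial expansion of `(T - 1) ^ n`.
  have hprod := tsum_mul_tsum_eq_tsum_sum_antidiagonal_of_summable_norm hA hB
  have hl : ∑' n : ℕ, (-x) ^ n / (n.factorial : ℝ) = Real.exp (-x) :=
    (hasSum_pow_div_factorial (-x)).tsum_eq
  have hr : poissonKernelOf T x c d =
      Real.exp (-x) * ∑' n : ℕ, x ^ n / (n.factorial : ℝ) * τ n := by
    rw [← tsum_mul_left]
    exact tsum_congr fun n => by rw [poissonWeight, mul_assoc]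
  rw [hr, ← hl, hprod]
  refine tsum_congr fun n => ?_
  have hpow : ((κ • (T - 1)) ^ n : Module.End ℝ (E → ℝ)) =
      ∑ ij ∈ Finset.HasAntidiagonal.antidiagonal n,
        (κ ^ n * (n.choose ij.1 : ℝ) * (-1) ^ ij.1) • T ^ ij.2 := by
    have hcomm : Commute (-1 : Module.End ℝ (E → ℝ)) T := (Commute.one_left T).neg_left
    rw [smul_pow, sub_eq_neg_add, hcomm.add_pow', Finset.smul_sum]
    refine Finset.sum_congr rfl fun ij _ => ?_
    have h1 : ((-1 : Module.End ℝ (E → ℝ)) ^ ij.1) = ((-1 : ℝ) ^ ij.1) • 1 := by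
      rw [← neg_one_smul ℝ (1 : Module.End ℝ (E → ℝ)), smul_pow, one_pow]
    rw [h1, smul_one_mul, ← Nat.cast_smul_eq_nsmul ℝ, smul_smul, smul_smul, mul_assoc]
  rw [hpow, LinearMap.sum_apply, Finset.sum_apply, Finset.mul_sum]
  refine Finset.sum_congr rfl fun ij hij => ?_
  obtain ⟨i, j⟩ := ij
  rw [Finset.HasAntidiagonal.mem_antidiagonal] at hij
  simp only at hij ⊢
  subst hij
  rw [LinearMap.smul_apply, Pi.smul_apply, smul_eq_mul, Nat.choose_symm_add, Nat.add_choose,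
    Nat.cast_div (Nat.factorial_mul_factorial_dvd_factorial_add i j) (by positivity)]
  have h1 : ((i + j).factorial : ℝ) ≠ 0 := by positivity
  have h2 : (i.factorial : ℝ) ≠ 0 := by positivity
  have h3 : (j.factorial : ℝ) ≠ 0 := by positivity
  push_cast
  rw [hx, neg_pow (κ * t) i]
  field_simp
  ring

theorem isErgodicTransition (hT : IsMarkovOperator T)
    (hirr : ∀ c d, ∃ n : ℕ, 0 < (T ^ n) (Pi.single d 1) c) {p : E → ℝ} (hp0 : ∀ c, 0 < p c)
    (hp : HasSum p 1) (hpi : IsInvariantFor T p) {κ : ℝ} (hκ : 0 < κ) :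
    IsErgodicTransition fun t c d => poissonKernelOf T (κ * t) c d := by
  refine ⟨fun c d => ⟨1, zero_le_one, ?_⟩, p, fun c => (hp0 c).le, hp, fun t ht d => ?_,
    fun c d => ?_⟩
  · obtain ⟨n, hn⟩ := hirr c d
    exact hT.poissonKernelOf_pos (by simpa using hκ) hn
  · exact hT.poissonKernelOf_stationary (fun c => (hp0 c).le) hpi (by positivity) d
  · exact (hT.tendsto_poissonKernelOf hirr hp0 hp hpi c d).comp
      (tendsto_id.const_mul_atTop hκ)

/-- A stationary distribution of the uniformized chain is invariant for `T`. -/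
theorem isInvariantFor_of_stationary (hT : IsMarkovOperator T) {p : E → ℝ} (hp0 : ∀ c, 0 ≤ p c)
    (hp : HasSum p 1)
    (hst : ∀ x, 0 ≤ x → ∀ d, HasSum (fun c => p c * poissonKernelOf T x c d) (p d)) :
    IsInvariantFor T p := by
  intro d
  have hs : ∀ n, Summable fun c => p c * (T ^ n) (Pi.single d 1) c := fun n =>
    Summable.of_nonneg_of_le (fun c => mul_nonneg (hp0 c) ((hT.pow n).single_nonneg c d))
      (fun c => mul_le_of_le_one_right (hp0 c) ((hT.pow n).single_le_one c d)) hp.summable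
  set m : ℕ → ℝ := fun n => ∑' c, p c * (T ^ n) (Pi.single d 1) c with hmdef
  have hm : ∀ n, HasSum (fun c => p c * (T ^ n) (Pi.single d 1) c) (m n) := fun n => (hs n).hasSum
  have hm0 : ∀ n, 0 ≤ m n := fun n => (hm n).nonneg fun c =>
    mul_nonneg (hp0 c) ((hT.pow n).single_nonneg c d)
  have hm1 : ∀ n, m n ≤ 1 := fun n =>
    hasSum_le (fun c => mul_le_of_le_one_right (hp0 c) ((hT.pow n).single_le_one c d)) (hm n) hp
  have hmix : ∀ x, 0 ≤ x → HasSum (fun n => poissonWeight x n * m n) (p d) := fun x hx => by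
    have hsum := (summable_poissonWeight_mul x (m := m) fun n => by
      rw [abs_of_nonneg (hm0 n)]; exact hm1 n).hasSum
    rwa [(hT.hasSum_mul_poissonKernelOf hp0 hx hm hsum).unique (hst x hx d)] at hsum
  have hpd : p d = m 0 := by
    have h := hasSum_single (f := fun n => poissonWeight 0 n * m n) 0 fun n hn => by
      simp [poissonWeight, hn]
    have h' := (hmix 0 le_rfl).unique h
    simpa [poissonWeight] using h'
  -- The mixture in `hmix` does not depend on `x`; its first-order coefficient at `0` is `m 1 - m
  -- 0`, and the remaining terms are at most `exp x - 1 - x ≤ x ^ 2`.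
  have hkey : ∀ x, 0 < x → x ≤ 1 → |m 1 - m 0| ≤ x := by
    intro x hx hx1
    have h1 : HasSum (fun n : ℕ => x ^ n / (n.factorial : ℝ) * (m n - m 0)) 0 := by
      have h := ((hmix x hx.le).sub ((hasSum_poissonWeight x).mul_right (p d))).mul_left
        (Real.exp x)
      rw [one_mul, sub_self, mul_zero] at h
      refine h.of_eq (fun n => ?_) rfl
      rw [hpd, ← mul_sub, poissonWeight, ← mul_assoc, ← mul_assoc, ← Real.exp_add, add_neg_cancel,
        Real.exp_zero, one_mul]
    have h2 := (hasSum_nat_add_iff' 2).2 h1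
    have h3 := (hasSum_nat_add_iff' 2).2 (hasSum_pow_div_factorial x)
    simp only [Finset.sum_range_succ, Finset.sum_range_zero, Nat.factorial, pow_zero, pow_one,
      sub_self, mul_zero, zero_add, Nat.cast_one, div_one, mul_one] at h2 h3
    have h4 : ∀ n : ℕ, |x ^ (n + 2) / ((n + 2).factorial : ℝ) * (m (n + 2) - m 0)| ≤
        x ^ (n + 2) / ((n + 2).factorial : ℝ) := fun n => by
      rw [abs_mul, abs_of_nonneg (by positivity)]
      refine mul_le_of_le_one_right (by positivity) (abs_le.2 ⟨?_, ?_⟩) <;>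
        linarith [hm0 (n + 2), hm1 (n + 2), hm0 0, hm1 0]
    have h5 : |0 - x * (m 1 - m 0)| ≤ Real.exp x - (1 + x) :=
      abs_le.2 ⟨hasSum_le (fun n => (abs_le.1 (h4 n)).1) h3.neg h2,
        hasSum_le (fun n => (abs_le.1 (h4 n)).2) h2 h3⟩
    have h6 := Real.abs_exp_sub_one_sub_id_le (x := x) (by rwa [abs_of_pos hx])
    have h7 : x * |m 1 - m 0| ≤ x * x := by
      rw [zero_sub, abs_neg, abs_mul, abs_of_pos hx] at h5
      have := (le_abs_self _).trans h6
      nlinarith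
    exact le_of_mul_le_mul_left h7 hx
  have heq : m 1 = m 0 := by
    by_contra hne
    have hpos : 0 < |m 1 - m 0| := abs_pos.2 (sub_ne_zero.2 hne)
    have h := hkey (min 1 (|m 1 - m 0| / 2)) (by positivity) (min_le_left _ _)
    have := min_le_right 1 (|m 1 - m 0| / 2)
    linarith
  have h := hm 1
  rw [heq, ← hpd, pow_one] at h
  exact h

end IsMarkovOperator

namespace IsMarkovOperator

variable {E : Type*} {T : Module.End ℝ (E → ℝ)} [DecidableEq E]

theorem pow_add_single_pos (hT : IsMarkovOperator T) {c e d : E} {m n : ℕ}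
    (h1 : 0 < (T ^ m) (Pi.single e 1) c) (h2 : 0 < (T ^ n) (Pi.single d 1) e) :
    0 < (T ^ (m + n)) (Pi.single d 1) c := by
  rw [pow_add, Module.End.mul_apply]
  refine (mul_pos h1 h2).trans_le ?_
  exact le_hasSum ((hT.pow m).hasSum_single_mul _ c) e fun e' _ =>
    mul_nonneg ((hT.pow m).single_nonneg c e') ((hT.pow n).single_nonneg e' d)

end IsMarkovOperator

/-! ### Uniformization and irreducibility of the queue -/

namespace MultiServerQueue

variable {N S : ℕ} (Q : MultiServerQueue N S)

theorem generator_apply (f : State N → ℝ) (c : State N) :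
    Q.generator f c = ∑ i : Fin N, Q.arrivalRate i * (f (c ++ [i]) - f c) +
      ∑ k : Fin c.length, Q.serviceRate c k * (f (c.eraseIdx k) - f c) := rfl

theorem serviceRate_nonneg (c : State N) (k : Fin c.length) : 0 ≤ Q.serviceRate c k :=
  Finset.sum_nonneg fun s _ => (Q.capacity_pos s).le

theorem totalCapacity_nonneg (A : Finset (Fin N)) : 0 ≤ Q.totalCapacity A :=
  Finset.sum_nonneg fun s _ => (Q.capacity_pos s).le

theorem totalCapacity_le (A : Finset (Fin N)) : Q.totalCapacity A ≤ ∑ s, Q.capacity s :=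
  Finset.sum_le_sum_of_subset_of_nonneg (Finset.subset_univ _) fun s _ _ => (Q.capacity_pos s).le

@[simp]
theorem totalCapacity_empty : Q.totalCapacity ∅ = 0 := by simp [totalCapacity]

theorem sum_serviceRate (c : State N) :
    ∑ k, Q.serviceRate c k = Q.totalCapacity c.toFinset := by
  simp only [serviceRate_eq]
  rw [Fin.sum_univ_eq_sum_range (fun k => Q.totalCapacity (c.take (k + 1)).toFinset -
    Q.totalCapacity (c.take k).toFinset), Finset.sum_range_sub
    (fun k => Q.totalCapacity (c.take k).toFinset)]
  simp

theorem generator_apply' (f : State N → ℝ) (c : State N) :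
    Q.generator f c = ∑ i : Fin N, Q.arrivalRate i * f (c ++ [i]) +
      ∑ k : Fin c.length, Q.serviceRate c k * f (c.eraseIdx k) -
        (∑ i, Q.arrivalRate i + Q.totalCapacity c.toFinset) * f c := by
  rw [generator_apply, ← sum_serviceRate]
  simp only [mul_sub, Finset.sum_sub_distrib, add_mul, Finset.sum_mul]
  ring

/-- A rate exceeding all the total jump rates of the queue. -/
noncomputable def maxRate : ℝ := ∑ i, Q.arrivalRate i + ∑ s, Q.capacity s + 1

theorem sum_arrivalRate_nonneg (A : Finset (Fin N)) : 0 ≤ ∑ i ∈ A, Q.arrivalRate i :=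
  Finset.sum_nonneg fun i _ => (Q.arrivalRate_pos i).le

/-- The summand `1` in `maxRate` covers the case without classes and servers. -/
theorem maxRate_pos : 0 < Q.maxRate := by
  have h1 := Q.sum_arrivalRate_nonneg Finset.univ
  have h2 : 0 ≤ ∑ s, Q.capacity s := Finset.sum_nonneg fun s _ => (Q.capacity_pos s).le
  unfold maxRate
  linarith

/-- The transition operator of the uniformized jump chain of the queue. -/
noncomputable def jumpOperator : Module.End ℝ (State N → ℝ) := 1 + Q.maxRate⁻¹ • Q.generator

theorem jumpOperator_apply (f : State N → ℝ) (c : State N) :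
    Q.jumpOperator f c = f c + Q.maxRate⁻¹ * Q.generator f c := rfl

theorem generator_eq_smul : Q.generator = Q.maxRate • (Q.jumpOperator - 1) := by
  rw [jumpOperator, add_sub_cancel_left, smul_smul, mul_inv_cancel₀ Q.maxRate_pos.ne', one_smul]

theorem generator_eq_mul (f : State N → ℝ) (c : State N) :
    Q.generator f c = Q.maxRate * (Q.jumpOperator f c - f c) := by
  rw [jumpOperator_apply, add_sub_cancel_left, mul_inv_cancel_left₀ Q.maxRate_pos.ne']

theorem jumps_nonneg {f : State N → ℝ} (hf : ∀ c, 0 ≤ f c) (c : State N) :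
    0 ≤ ∑ i : Fin N, Q.arrivalRate i * f (c ++ [i]) +
      ∑ k : Fin c.length, Q.serviceRate c k * f (c.eraseIdx k) :=
  add_nonneg (Finset.sum_nonneg fun i _ => mul_nonneg (Q.arrivalRate_pos i).le (hf _))
    (Finset.sum_nonneg fun k _ => mul_nonneg (Q.serviceRate_nonneg c k) (hf _))

/-- The discarded term is the probability of staying put, nonnegative because `maxRate` dominates
the total jump rate. -/
theorem jumps_le_jumpOperator {f : State N → ℝ} (hf : ∀ c, 0 ≤ f c) (c : State N) :
    Q.maxRate⁻¹ * (∑ i : Fin N, Q.arrivalRate i * f (c ++ [i]) +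
      ∑ k : Fin c.length, Q.serviceRate c k * f (c.eraseIdx k)) ≤ Q.jumpOperator f c := by
  have h : 0 ≤ Q.maxRate⁻¹ *
      ((Q.maxRate - (∑ i, Q.arrivalRate i + Q.totalCapacity c.toFinset)) * f c) := by
    refine mul_nonneg (inv_nonneg.2 Q.maxRate_pos.le) (mul_nonneg ?_ (hf c))
    have := Q.totalCapacity_le c.toFinset
    unfold maxRate
    linarith
  rw [sub_mul, mul_sub, inv_mul_cancel_left₀ Q.maxRate_pos.ne'] at h
  rw [jumpOperator_apply, generator_apply', mul_sub]
  linarith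

theorem isMarkovOperator_jumpOperator : IsMarkovOperator Q.jumpOperator where
  nonneg f hf c := (mul_nonneg (inv_nonneg.2 Q.maxRate_pos.le) (Q.jumps_nonneg hf c)).trans
    (Q.jumps_le_jumpOperator hf c)
  map_one := by
    funext c
    simp [jumpOperator_apply, generator_apply]
  exists_finset c := by
    refine ⟨insert c (Finset.univ.image (fun i => c ++ [i]) ∪
      Finset.univ.image fun k : Fin c.length => c.eraseIdx k), fun f hf => ?_⟩
    have h1 : ∀ i, f (c ++ [i]) = 0 := fun i => hf _ (by simp)
    have h2 : ∀ k : Fin c.length, f (c.eraseIdx k) = 0 := fun k => hf _ <|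
      Finset.mem_insert_of_mem <| Finset.mem_union_right _ <|
        Finset.mem_image_of_mem _ (Finset.mem_univ k)
    have h3 : f c = 0 := hf _ (by simp)
    simp [jumpOperator_apply, generator_apply, h1, h2, h3]

theorem transitionProb_eq (t : ℝ) (c d : State N) :
    Q.transitionProb t c d = poissonKernelOf Q.jumpOperator (Q.maxRate * t) c d := by
  rw [← Q.isMarkovOperator_jumpOperator.tsum_pow_smul_sub_one, ← generator_eq_smul]
  rfl

theorem single_state_nonneg (d c : State N) : 0 ≤ (Pi.single d 1 : State N → ℝ) c :=
  (Pi.single_nonneg.2 zero_le_one : (0 : State N → ℝ) ≤ Pi.single d 1) c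

theorem jumpOperator_append_pos (c : State N) (i : Fin N) :
    0 < Q.jumpOperator (Pi.single (c ++ [i]) 1) c := by
  refine lt_of_lt_of_le (mul_pos (inv_pos.2 Q.maxRate_pos) ?_)
    (Q.jumps_le_jumpOperator (single_state_nonneg _) c)
  refine add_pos_of_pos_of_nonneg ?_ (Finset.sum_nonneg fun k _ =>
    mul_nonneg (Q.serviceRate_nonneg c k) (single_state_nonneg _ _))
  refine Finset.sum_pos' (fun j _ => mul_nonneg (Q.arrivalRate_pos j).le (single_state_nonneg _ _))
    ⟨i, Finset.mem_univ i, ?_⟩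
  simpa using Q.arrivalRate_pos i

theorem jumpOperator_head_pos {i : Fin N} (hi : 0 < Q.totalCapacity {i}) (c : State N) :
    0 < Q.jumpOperator (Pi.single c 1) (i :: c) := by
  refine lt_of_lt_of_le (mul_pos (inv_pos.2 Q.maxRate_pos) ?_)
    (Q.jumps_le_jumpOperator (single_state_nonneg _) _)
  refine add_pos_of_nonneg_of_pos (Finset.sum_nonneg fun k _ =>
    mul_nonneg (Q.arrivalRate_pos k).le (single_state_nonneg _ _)) ?_
  refine Finset.sum_pos' (fun j _ => mul_nonneg (Q.serviceRate_nonneg _ j)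
    (single_state_nonneg _ _)) ⟨⟨0, by simp⟩, Finset.mem_univ _, ?_⟩
  simpa [serviceRate_eq] using hi

/-- The path goes through the empty state: serve the head of `c` repeatedly, then let the jobs of
`d` arrive in order. -/
theorem jumpOperator_irreducible (h : ∀ i, 0 < Q.totalCapacity {i}) (c d : State N) :
    ∃ n : ℕ, 0 < (Q.jumpOperator ^ n) (Pi.single d 1) c := by
  have hT := Q.isMarkovOperator_jumpOperator
  have h1 : ∃ n : ℕ, 0 < (Q.jumpOperator ^ n) (Pi.single [] 1) c := by
    induction c with
    | nil => exact ⟨0, by simp⟩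
    | cons i c ih =>
      obtain ⟨n, hn⟩ := ih
      exact ⟨1 + n, hT.pow_add_single_pos (by simpa using Q.jumpOperator_head_pos (h i) c) hn⟩
  have h2 : ∃ n : ℕ, 0 < (Q.jumpOperator ^ n) (Pi.single d 1) [] := by
    induction d using List.reverseRecOn with
    | nil => exact ⟨0, by simp⟩
    | append_singleton d i ih =>
      obtain ⟨n, hn⟩ := ih
      exact ⟨n + 1, hT.pow_add_single_pos hn (by simpa using Q.jumpOperator_append_pos d i)⟩
  obtain ⟨m, hm⟩ := h1
  obtain ⟨n, hn⟩ := h2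
  exact ⟨m + n, hT.pow_add_single_pos hm hn⟩

/-! ### Necessity: the drift of the number of jobs -/

/-- The number of jobs whose class belongs to `A`. -/
def countJobs (A : Finset (Fin N)) (c : State N) : ℕ := c.countP (· ∈ A)

theorem countJobs_append (A : Finset (Fin N)) (c : State N) (i : Fin N) :
    countJobs A (c ++ [i]) = countJobs A c + if i ∈ A then 1 else 0 := by
  simp [countJobs, List.countP_append, List.countP_cons]

theorem countJobs_eraseIdx (A : Finset (Fin N)) (c : State N) (k : Fin c.length) :
    countJobs A c = countJobs A (c.eraseIdx k) + if c.get k ∈ A then 1 else 0 := by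
  unfold countJobs
  rw [← (List.getElem_cons_eraseIdx_perm k.2).countP_eq, List.countP_cons]
  simp

/-- The servers active at distinct positions form disjoint sets, and those working on classes of `A`
are compatible with `A`. -/
theorem sum_serviceRate_filter_le (A : Finset (Fin N)) (c : State N) :
    ∑ k with c.get k ∈ A, Q.serviceRate c k ≤ Q.totalCapacity A := by
  unfold serviceRate totalCapacity
  rw [← Finset.sum_biUnion]
  · refine Finset.sum_le_sum_of_subset_of_nonneg (fun s hs => ?_)
      fun s _ _ => (Q.capacity_pos s).le
    simp only [Finset.mem_biUnion, Finset.mem_filter, Finset.mem_univ, true_and,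
      Finset.mem_sdiff] at hs ⊢
    obtain ⟨k, hk, hs, -⟩ := hs
    exact ⟨_, hk, hs⟩
  · have key : ∀ k l : Fin c.length, k < l →
        Disjoint (Q.servers (c.get k) \ (c.take k).toFinset.biUnion Q.servers)
          (Q.servers (c.get l) \ (c.take l).toFinset.biUnion Q.servers) := by
      intro k l hkl
      refine Finset.disjoint_left.2 fun s hs hs' => (Finset.mem_sdiff.1 hs').2 ?_
      refine Finset.mem_biUnion.2 ⟨c.get k, ?_, (Finset.mem_sdiff.1 hs).1⟩
      rw [List.mem_toFinset, List.mem_take_iff_getElem]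
      exact ⟨k, by simpa using hkl, rfl⟩
    intro k _ l _ hkl
    rcases lt_or_gt_of_ne hkl with h | h
    · exact key k l h
    · exact (key l k h).symm

theorem generator_countJobs (A : Finset (Fin N)) (c : State N) :
    Q.generator (fun e => (countJobs A e : ℝ)) c =
      ∑ i ∈ A, Q.arrivalRate i - ∑ k with c.get k ∈ A, Q.serviceRate c k := by
  rw [generator_apply, sub_eq_add_neg, ← Finset.sum_neg_distrib, Finset.sum_filter]
  congr 1
  · simp only [countJobs_append]
    simp [mul_ite]
  · refine Finset.sum_congr rfl fun k _ => ?_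
    rw [countJobs_eraseIdx A c k]
    split_ifs <;> simp

theorem abs_generator_le_of_lipschitz {f : State N → ℝ}
    (h1 : ∀ c i, |f (c ++ [i]) - f c| ≤ 1)
    (h2 : ∀ (c : State N) (k : Fin c.length), |f (c.eraseIdx k) - f c| ≤ 1) (c : State N) :
    |Q.generator f c| ≤ Q.maxRate := by
  have h3 : |∑ i, Q.arrivalRate i * (f (c ++ [i]) - f c)| ≤ ∑ i, Q.arrivalRate i := by
    refine (Finset.abs_sum_le_sum_abs _ _).trans (Finset.sum_le_sum fun i _ => ?_)
    rw [abs_mul, abs_of_pos (Q.arrivalRate_pos i)]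
    exact mul_le_of_le_one_right (Q.arrivalRate_pos i).le (h1 c i)
  have h4 : |∑ k : Fin c.length, Q.serviceRate c k * (f (c.eraseIdx k) - f c)| ≤
      ∑ k, Q.serviceRate c k := by
    refine (Finset.abs_sum_le_sum_abs _ _).trans (Finset.sum_le_sum fun k _ => ?_)
    rw [abs_mul, abs_of_nonneg (Q.serviceRate_nonneg c k)]
    exact mul_le_of_le_one_right (Q.serviceRate_nonneg c k) (h2 c k)
  rw [sum_serviceRate] at h4
  have h5 := Q.totalCapacity_le c.toFinset
  rw [generator_apply]
  refine (abs_add_le _ _).trans ?_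
  unfold maxRate
  linarith

/-- In equilibrium, the mean drift of the number of jobs of classes in `A` vanishes. -/
theorem hasSum_mul_drift {p : State N → ℝ} (hp0 : ∀ c, 0 ≤ p c) (hp : HasSum p 1)
    (hpi : IsInvariantFor Q.jumpOperator p) (A : Finset (Fin N)) :
    HasSum (fun c => p c * Q.generator (fun e => (countJobs A e : ℝ)) c) 0 := by
  -- The count need not be integrable under `p`, so it is truncated at `K`; the drifts are bounded
  -- by `maxRate` uniformly in `K`, which permits the limit.
  set f : ℕ → State N → ℝ := fun K e => ((min (countJobs A e) K : ℕ) : ℝ) with hf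
  have hzero : ∀ K, HasSum (fun c => p c * Q.generator (f K) c) 0 := fun K => by
    have hs : Summable fun c => p c * f K c :=
      Summable.of_nonneg_of_le (fun c => mul_nonneg (hp0 c) (Nat.cast_nonneg _))
        (fun c => mul_le_mul_of_nonneg_left (Nat.cast_le.2 (min_le_right _ _)) (hp0 c))
        (hp.summable.mul_right (K : ℝ))
    have h1 := Q.isMarkovOperator_jumpOperator.hasSum_mul_apply hp0 hpi
      (fun c => Nat.cast_nonneg _) hs.hasSum
    exact ((h1.sub hs.hasSum).mul_left Q.maxRate).of_eq
      (fun c => by rw [generator_eq_mul]; ring) (by simp)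
  have hcast : ∀ a b : ℕ, a ≤ b + 1 → b ≤ a + 1 → |(a : ℝ) - b| ≤ 1 := fun a b h1 h2 => by
    have h1' : (a : ℝ) ≤ b + 1 := by exact_mod_cast h1
    have h2' : (b : ℝ) ≤ a + 1 := by exact_mod_cast h2
    exact abs_le.2 ⟨by linarith, by linarith⟩
  have hbound : ∀ K c, |Q.generator (f K) c| ≤ Q.maxRate := fun K => by
    refine Q.abs_generator_le_of_lipschitz (fun c i => ?_) fun c k => ?_
    · have := countJobs_append A c i
      apply hcast <;> split_ifs at this <;> omega
    · have := countJobs_eraseIdx A c k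
      apply hcast <;> split_ifs at this <;> omega
  have hlim : ∀ c, Tendsto (fun K => Q.generator (f K) c) atTop
      (𝓝 (Q.generator (fun e => (countJobs A e : ℝ)) c)) := fun c => by
    refine tendsto_const_nhds.congr' ?_
    -- The `+ 1` leaves room for an arrival: the truncation is then invisible at `c` and at all its
    -- neighbours.
    filter_upwards [eventually_ge_atTop (countJobs A c + 1)] with K hK
    have h0 : f K c = countJobs A c := by
      simp only [hf]; congr 1; omega
    have h1 : ∀ i, f K (c ++ [i]) = countJobs A (c ++ [i]) := fun i => by
      have := countJobs_append A c i
      simp only [hf]; congr 1; split_ifs at this <;> omega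
    have h2 : ∀ k : Fin c.length, f K (c.eraseIdx k) = countJobs A (c.eraseIdx k) := fun k => by
      have := countJobs_eraseIdx A c k
      simp only [hf]; congr 1; split_ifs at this <;> omega
    simp only [generator_apply, h0, h1, h2]
  have hbound' : ∀ c, |Q.generator (fun e => (countJobs A e : ℝ)) c| ≤ Q.maxRate := fun c =>
    le_of_tendsto (hlim c).abs (Eventually.of_forall fun K => hbound K c)
  have hs : Summable fun c => p c * Q.generator (fun e => (countJobs A e : ℝ)) c := by
    refine Summable.of_norm_bounded (hp.summable.mul_right Q.maxRate) fun c => ?_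
    rw [norm_mul, Real.norm_of_nonneg (hp0 c)]
    exact mul_le_mul_of_nonneg_left (hbound' c) (hp0 c)
  have ht := tendsto_tsum_of_dominated_convergence (hp.summable.mul_right Q.maxRate)
    (fun c => (hlim c).const_mul (p c)) (Eventually.of_forall fun K c => by
      rw [norm_mul, Real.norm_of_nonneg (hp0 c)]
      exact mul_le_mul_of_nonneg_left (hbound K c) (hp0 c))
  simp only [fun K => (hzero K).tsum_eq] at ht
  rw [tendsto_nhds_unique tendsto_const_nhds ht]
  exact hs.hasSum

theorem IsStable.sum_arrivalRate_lt {Q : MultiServerQueue N S} (h : Q.IsStable)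
    {A : Finset (Fin N)} (hA : A.Nonempty) : ∑ i ∈ A, Q.arrivalRate i < Q.totalCapacity A := by
  obtain ⟨hirr, p, hp0, hp, hst, -⟩ := h
  have hT := Q.isMarkovOperator_jumpOperator
  have hP : ∀ t, 0 ≤ t → ∀ c d, 0 ≤ Q.transitionProb t c d := fun t ht c d => by
    rw [transitionProb_eq]
    exact hT.poissonKernelOf_nonneg (mul_nonneg Q.maxRate_pos.le ht) c d
  have hpi : IsInvariantFor Q.jumpOperator p :=
    hT.isInvariantFor_of_stationary hp0 hp fun x hx d => by
      have := hst (x / Q.maxRate) (div_nonneg hx Q.maxRate_pos.le) d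
      simpa only [transitionProb_eq, mul_div_cancel₀ x Q.maxRate_pos.ne'] using this
  have hnil : 0 < p [] := by
    obtain ⟨c, hc⟩ : ∃ c, 0 < p c := by
      by_contra! hle
      have : p = 0 := funext fun c => le_antisymm (hle c) (hp0 c)
      subst this
      exact zero_ne_one (hasSum_zero.unique hp)
    obtain ⟨t, ht, hpos⟩ := hirr c []
    exact (mul_pos hc hpos).trans_le
      (le_hasSum (hst t ht []) c fun e _ => mul_nonneg (hp0 e) (hP t ht e []))
  by_contra! hle
  have hdrift := Q.hasSum_mul_drift hp0 hp hpi A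
  simp only [generator_countJobs] at hdrift
  have h0 := le_hasSum hdrift [] fun c _ => mul_nonneg (hp0 c) <| by
    have := Q.sum_serviceRate_filter_le A c
    linarith
  have h1 : 0 < ∑ i ∈ A, Q.arrivalRate i := Finset.sum_pos (fun i _ => Q.arrivalRate_pos i) hA
  have h2 := mul_pos hnil h1
  simp at h0
  linarith

end MultiServerQueue

/-! ### Sufficiency: product form and partial balance -/

theorem List.insertIdx_append_left {α : Type*} (l l' : List α) (a : α) {k : ℕ}
    (hk : k ≤ l.length) : (l ++ l').insertIdx k a = l.insertIdx k a ++ l' := by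
  induction l generalizing k with
  | nil =>
    obtain rfl : k = 0 := by simpa using hk
    simp
  | cons b l ih =>
    cases k with
    | zero => simp
    | succ k => simp [ih (Nat.le_of_succ_le_succ hk)]

theorem List.take_succ_insertIdx {α : Type*} (l : List α) (a : α) {k : ℕ}
    (hk : k ≤ l.length) : (l.insertIdx k a).take (k + 1) = l.take k ++ [a] := by
  induction l generalizing k with
  | nil =>
    obtain rfl : k = 0 := by simpa using hk
    simp
  | cons b l ih =>
    cases k with
    | zero => simp
    | succ k => simp [ih (Nat.le_of_succ_le_succ hk)]

theorem List.toFinset_insertIdx {α : Type*} [DecidableEq α] (l : List α) (a : α) {k : ℕ}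
    (hk : k ≤ l.length) : (l.insertIdx k a).toFinset = insert a l.toFinset := by
  ext b
  simp [List.mem_insertIdx hk]

theorem List.eq_insertIdx_iff_eraseIdx_eq {α : Type*} {l l' : List α} {k : ℕ}
    (hk : k < l.length) (a : α) : l = l'.insertIdx k a ↔ l.eraseIdx k = l' ∧ l[k] = a := by
  constructor
  · rintro rfl
    exact ⟨List.eraseIdx_insertIdx_self a, List.getElem_insertIdx_self hk⟩
  · rintro ⟨rfl, rfl⟩
    exact (List.insertIdx_eraseIdx_getElem hk).symm

namespace MultiServerQueue

variable {N S : ℕ} (Q : MultiServerQueue N S)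

/-- The product-form weight of the state `c.reverse`. -/
noncomputable def revWeight : State N → ℝ
  | [] => 1
  | i :: c => Q.arrivalRate i / Q.totalCapacity (i :: c).toFinset * revWeight c

/-- The product-form weight of a state. -/
noncomputable def weight (c : State N) : ℝ := Q.revWeight c.reverse

theorem weight_append (c : State N) (i : Fin N) :
    Q.weight (c ++ [i]) =
      Q.arrivalRate i / Q.totalCapacity (insert i c.toFinset) * Q.weight c := by
  simp [weight, revWeight]

/-- The subset condition for stability. -/
def IsSubcritical : Prop :=
  ∀ A : Finset (Fin N), A.Nonempty → ∑ i ∈ A, Q.arrivalRate i < Q.totalCapacity A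

variable {Q}

theorem IsSubcritical.totalCapacity_pos (h : Q.IsSubcritical) {A : Finset (Fin N)}
    (hA : A.Nonempty) : 0 < Q.totalCapacity A :=
  (Q.sum_arrivalRate_nonneg A).trans_lt (h A hA)

theorem IsSubcritical.totalCapacity_insert_pos (h : Q.IsSubcritical) (i : Fin N)
    (A : Finset (Fin N)) : 0 < Q.totalCapacity (insert i A) :=
  h.totalCapacity_pos (Finset.insert_nonempty i A)

theorem IsSubcritical.revWeight_pos (h : Q.IsSubcritical) (c : State N) : 0 < Q.revWeight c := by
  induction c with
  | nil => exact one_pos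
  | cons i c ih =>
    rw [revWeight, List.toFinset_cons]
    exact mul_pos (div_pos (Q.arrivalRate_pos i) (h.totalCapacity_insert_pos i _)) ih

theorem IsSubcritical.weight_append_mul (h : Q.IsSubcritical) (c : State N) (i : Fin N) :
    Q.weight (c ++ [i]) * Q.totalCapacity (insert i c.toFinset) =
      Q.arrivalRate i * Q.weight c := by
  have := (h.totalCapacity_insert_pos i c.toFinset).ne'
  rw [weight_append]
  field_simp

/-- Partial balance: the flow out of `d` due to the arrivals of class `i` equals the flow into `d`
due to the departures of class `i`. -/
theorem IsSubcritical.sum_weight_insertIdx (h : Q.IsSubcritical) (d : State N) (i : Fin N) :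
    ∑ k ∈ Finset.range (d.length + 1), Q.weight (d.insertIdx k i) *
      (Q.totalCapacity (insert i (d.take k).toFinset) - Q.totalCapacity (d.take k).toFinset) =
        Q.arrivalRate i * Q.weight d := by
  induction d using List.reverseRecOn with
  | nil =>
    have := h.weight_append_mul [] i
    simpa using this
  | append_singleton d j ih =>
    have hlen : (d ++ [j]).length = d.length + 1 := by simp
    have hset : (d ++ [j]).toFinset = insert j d.toFinset := by simp
    have hpos := h.totalCapacity_insert_pos i (insert j d.toFinset)
    -- If `i` is inserted before the final `j`, the factor of `j` does not depend on `k`, and the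
    -- induction hypothesis applies. Only insertion at the very end remains.
    have h1 : ∀ k ∈ Finset.range (d.length + 1), Q.weight ((d ++ [j]).insertIdx k i) *
        (Q.totalCapacity (insert i ((d ++ [j]).take k).toFinset) -
          Q.totalCapacity ((d ++ [j]).take k).toFinset) =
        Q.arrivalRate j / Q.totalCapacity (insert i (insert j d.toFinset)) *
          (Q.weight (d.insertIdx k i) * (Q.totalCapacity (insert i (d.take k).toFinset) -
            Q.totalCapacity (d.take k).toFinset)) := by
      intro k hk
      have hk' : k ≤ d.length := Nat.le_of_lt_succ (Finset.mem_range.1 hk)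
      rw [List.insertIdx_append_left _ _ _ hk', weight_append, List.toFinset_insertIdx _ _ hk',
        List.take_append_of_le_length hk', Finset.insert_comm j i]
      ring
    rw [hlen, Finset.sum_range_succ, Finset.sum_congr rfl h1, ← Finset.mul_sum, ih, ← hlen,
      List.insertIdx_length_self, List.take_length, hset]
    have h2 := h.weight_append_mul (d ++ [j]) i
    have h3 := h.weight_append_mul d j
    rw [hset] at h2
    rw [mul_sub, h2, weight_append _ (d ++ [j]), hset]
    field_simp
    linear_combination (-Q.arrivalRate i) * h3

/-- A nonempty `d` has one predecessor by arrival, obtained by dropping its last job. The weight is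
defined so that this inflow equals the outflow of `d` by services. -/
theorem hasSum_weight_mul_arrival (h : Q.IsSubcritical) (d : State N) :
    HasSum (fun c => Q.weight c * ∑ i, Q.arrivalRate i * (Pi.single d 1 : State N → ℝ) (c ++ [i]))
      (Q.weight d * Q.totalCapacity d.toFinset) := by
  induction d using List.reverseRecOn with
  | nil =>
    refine hasSum_zero.of_eq (fun c => ?_) (by simp)
    simp
  | append_singleton d j _ =>
    refine (hasSum_ite_eq d (Q.weight d * Q.arrivalRate j)).of_eq (fun c => ?_) ?_
    · by_cases hc : c = d
      · subst hc
        simp [Pi.single_apply]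
      · simp [hc]
    · have := h.weight_append_mul d j
      simp only [List.toFinset_append, List.toFinset_cons, List.toFinset_nil] at this ⊢
      rw [Finset.union_comm, LawfulSingleton.insert_empty_eq, ← Finset.insert_eq, this, mul_comm]

/-- The predecessors of `d` by departure are its one-letter insertions. Inserting into a run of
equal classes gives the same `c` several times, matching the several positions whose removal yields
`d`. -/
theorem sum_serviceRate_mul_single_eraseIdx (c d : State N) :
    ∑ k : Fin c.length, Q.serviceRate c k * (Pi.single d 1 : State N → ℝ) (c.eraseIdx k) =
      ∑ i, ∑ k ∈ Finset.range (d.length + 1), if c = d.insertIdx k i then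
        Q.totalCapacity (insert i (d.take k).toFinset) - Q.totalCapacity (d.take k).toFinset
      else 0 := by
  rw [Finset.sum_comm]
  have hins : ∀ k ∈ Finset.range (d.length + 1), ∀ i, (d.insertIdx k i).length = d.length + 1 :=
    fun k hk i => List.length_insertIdx_of_le_length (Nat.le_of_lt_succ (Finset.mem_range.1 hk)) i
  by_cases hlen : c.length = d.length + 1
  · simp only [serviceRate_eq]
    rw [Fin.sum_univ_eq_sum_range (fun k => (Q.totalCapacity (c.take (k + 1)).toFinset -
      Q.totalCapacity (c.take k).toFinset) * (Pi.single d 1 : State N → ℝ) (c.eraseIdx k)), hlen]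
    refine Finset.sum_congr rfl fun k hk => ?_
    have hk' : k < c.length := hlen ▸ Finset.mem_range.1 hk
    simp only [List.eq_insertIdx_iff_eraseIdx_eq hk']
    by_cases hcd : c.eraseIdx k = d
    · have hc : c = d.insertIdx k (c.get ⟨k, hk'⟩) := (List.eq_insertIdx_iff_eraseIdx_eq hk' _).2 ⟨hcd, rfl⟩
      have hkd : k ≤ d.length := Nat.le_of_lt_succ (Finset.mem_range.1 hk)
      have h1 : (c.take (k + 1)).toFinset = insert (c.get ⟨k, hk'⟩) (d.take k).toFinset := by
        conv_lhs => rw [hc]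
        rw [List.take_succ_insertIdx _ _ hkd]
        ext; simp
      have h2 : c.take k = d.take k := by
        rw [← hcd, List.take_eraseIdx_eq_take_of_le _ _ _ le_rfl]
      simp [hcd, h1, h2]
    · simp [hcd]
  · rw [Finset.sum_eq_zero, Finset.sum_eq_zero]
    · intro k hk
      refine Finset.sum_eq_zero fun i _ => if_neg ?_
      rintro rfl
      exact hlen (hins k hk i)
    · intro k _
      rw [Pi.single_eq_of_ne, mul_zero]
      rintro rfl
      rw [List.length_eraseIdx_of_lt k.2] at hlen
      have := k.2
      omega

theorem hasSum_weight_mul_service (h : Q.IsSubcritical) (d : State N) :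
    HasSum (fun c => Q.weight c *
      ∑ k : Fin c.length, Q.serviceRate c k * (Pi.single d 1 : State N → ℝ) (c.eraseIdx k))
      ((∑ i, Q.arrivalRate i) * Q.weight d) := by
  have h1 : HasSum (fun c => ∑ i, ∑ k ∈ Finset.range (d.length + 1),
      if c = d.insertIdx k i then Q.weight (d.insertIdx k i) *
        (Q.totalCapacity (insert i (d.take k).toFinset) - Q.totalCapacity (d.take k).toFinset)
      else 0) (∑ i, ∑ k ∈ Finset.range (d.length + 1), Q.weight (d.insertIdx k i) *
        (Q.totalCapacity (insert i (d.take k).toFinset) - Q.totalCapacity (d.take k).toFinset)) :=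
    hasSum_sum fun i _ => hasSum_sum fun k _ => hasSum_ite_eq _ _
  refine h1.of_eq (fun c => ?_) ?_
  · rw [sum_serviceRate_mul_single_eraseIdx, Finset.mul_sum]
    refine Finset.sum_congr rfl fun i _ => ?_
    rw [Finset.mul_sum]
    refine Finset.sum_congr rfl fun k _ => ?_
    split_ifs with hc
    · rw [← hc]
    · rw [mul_zero]
  · rw [Finset.sum_mul]
    exact Finset.sum_congr rfl fun i _ => (h.sum_weight_insertIdx d i).symm

theorem hasSum_weight_mul_generator (h : Q.IsSubcritical) (d : State N) :
    HasSum (fun c => Q.weight c * Q.generator (Pi.single d 1) c) 0 := by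
  have h3 := hasSum_ite_eq d ((∑ i, Q.arrivalRate i + Q.totalCapacity d.toFinset) * Q.weight d)
  refine (((hasSum_weight_mul_arrival h d).add (hasSum_weight_mul_service h d)).sub h3).of_eq
    (fun c => ?_) (by ring)
  rw [generator_apply']
  by_cases hc : c = d
  · subst hc
    simp only [Pi.single_eq_same, if_true]
    ring
  · simp only [Pi.single_eq_of_ne hc, if_neg hc]
    ring

theorem IsSubcritical.isInvariantFor_weight (h : Q.IsSubcritical) :
    IsInvariantFor Q.jumpOperator Q.weight := by
  intro d
  refine ((hasSum_ite_eq d (Q.weight d)).add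
    ((hasSum_weight_mul_generator h d).mul_left Q.maxRate⁻¹)).of_eq (fun c => ?_) (by simp)
  rw [jumpOperator_apply]
  by_cases hc : c = d
  · subst hc
    simp only [Pi.single_eq_same, if_true]
    ring
  · simp only [Pi.single_eq_of_ne hc, if_neg hc]
    ring

/-! ### Sufficiency: finite total weight -/

/-- A supersolution of the recursion for the total weight of the extensions of a state, which
depends only on the set of classes present in the state. -/
theorem IsSubcritical.exists_supersolution (h : Q.IsSubcritical) :
    ∃ V : Finset (Fin N) → ℝ, (∀ A, 0 ≤ V A) ∧
      ∀ A, 1 + ∑ i, Q.arrivalRate i / Q.totalCapacity (insert i A) * V (insert i A) ≤ V A := by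
  set B : Finset (Fin N) → ℝ := fun A =>
    1 + ∑ i ∈ Aᶜ, Q.arrivalRate i / Q.totalCapacity (insert i A) with hB
  -- The slack of the stability condition; at `∅` the quotient `0 / 0` is `0`, so the slack is `1`.
  set δ : Finset (Fin N) → ℝ := fun A => 1 - (∑ i ∈ A, Q.arrivalRate i) / Q.totalCapacity A with hδ
  have hδpos : ∀ A, 0 < δ A := fun A => by
    rcases A.eq_empty_or_nonempty with rfl | hA
    · simp [hδ]
    · have := (div_lt_one (h.totalCapacity_pos hA)).2 (h A hA)
      simp only [hδ]
      linarith
  have hBone : ∀ A, 1 ≤ B A := fun A => by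
    have : 0 ≤ ∑ i ∈ Aᶜ, Q.arrivalRate i / Q.totalCapacity (insert i A) :=
      Finset.sum_nonneg fun i _ => div_nonneg (Q.arrivalRate_pos i).le (Q.totalCapacity_nonneg _)
    simp only [hB]
    linarith
  have hquot : ∀ A, 0 ≤ B A / δ A := fun A =>
    div_nonneg (zero_le_one.trans (hBone A)) (hδpos A).le
  set M : ℝ := 1 + ∑ A, B A / δ A with hM
  have hM1 : 1 ≤ M := by
    have := Finset.sum_nonneg fun A (_ : A ∈ (Finset.univ : Finset (Finset (Fin N)))) => hquot A
    linarith
  have hMδ : ∀ A, B A ≤ M * δ A := fun A => by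
    rw [← div_le_iff₀ (hδpos A)]
    have := Finset.single_le_sum (fun A _ => hquot A) (Finset.mem_univ A)
    linarith
  -- Each new class costs a factor `M`, chosen with `B A ≤ M * δ A`, so the slack on repeated
  -- classes absorbs the new ones. The `+ 1` keeps a factor `M` for the full set of classes.
  refine ⟨fun A => M ^ (N + 1 - A.card), fun A => by positivity, fun A => ?_⟩
  have hcard : A.card ≤ N := by simpa using Finset.card_le_univ A
  obtain ⟨m, hm⟩ := Nat.exists_eq_add_of_le hcard
  have hVA : N + 1 - A.card = m + 1 := by omega
  have hin : ∑ i ∈ A, Q.arrivalRate i / Q.totalCapacity (insert i A) *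
      M ^ (N + 1 - (insert i A).card) = (1 - δ A) * M ^ (m + 1) := by
    simp only [hδ, sub_sub_cancel]
    rw [Finset.sum_div, Finset.sum_mul]
    refine Finset.sum_congr rfl fun i hi => ?_
    rw [Finset.insert_eq_of_mem hi, hVA]
  have hout : ∑ i ∈ Aᶜ, Q.arrivalRate i / Q.totalCapacity (insert i A) *
      M ^ (N + 1 - (insert i A).card) = (B A - 1) * M ^ m := by
    simp only [hB, add_sub_cancel_left]
    rw [Finset.sum_mul]
    refine Finset.sum_congr rfl fun i hi => ?_
    rw [Finset.card_insert_of_notMem (Finset.mem_compl.1 hi)]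
    congr 2
    omega
  simp only
  rw [← Finset.sum_add_sum_compl A, hin, hout, hVA]
  have h1 : 1 ≤ M ^ m := one_le_pow₀ hM1
  have h2 := mul_le_mul_of_nonneg_left (hMδ A) (zero_le_one.trans h1)
  rw [pow_succ]
  nlinarith

/-- The states with `n` jobs. -/
def statesOfLength (N : ℕ) : ℕ → Finset (State N)
  | 0 => {[]}
  | n + 1 => (Finset.univ ×ˢ statesOfLength N n).image fun x => x.1 :: x.2

theorem mem_statesOfLength (c : State N) : c ∈ statesOfLength N c.length := by
  induction c with
  | nil => simp [statesOfLength]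
  | cons i c ih => simpa [statesOfLength] using ih

theorem length_of_mem_statesOfLength {n : ℕ} {c : State N} (h : c ∈ statesOfLength N n) :
    c.length = n := by
  induction n generalizing c with
  | zero => simpa [statesOfLength] using h
  | succ n ih =>
    obtain ⟨⟨i, d⟩, hd, rfl⟩ := Finset.mem_image.1 h
    simp [ih (Finset.mem_product.1 hd).2]

theorem sum_statesOfLength_succ (f : State N → ℝ) (n : ℕ) :
    ∑ c ∈ statesOfLength N (n + 1), f c = ∑ c ∈ statesOfLength N n, ∑ i, f (i :: c) := by
  rw [statesOfLength, Finset.sum_image, Finset.sum_product_right]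
  rintro ⟨i, c⟩ _ ⟨j, d⟩ _ hcd
  simpa using hcd

/-- The weight of the words shorter than `n`, plus the sum over length `n` weighted by `V`, is
nonincreasing in `n` and starts at `V ∅`, which therefore bounds all partial sums. -/
theorem IsSubcritical.summable_revWeight (h : Q.IsSubcritical) : Summable Q.revWeight := by
  obtain ⟨V, hV0, hV⟩ := h.exists_supersolution
  have hw := fun c => (h.revWeight_pos c).le
  have hlevel : ∀ n, ∑ m ∈ Finset.range n, ∑ c ∈ statesOfLength N m, Q.revWeight c +
      ∑ c ∈ statesOfLength N n, Q.revWeight c * V c.toFinset ≤ V ∅ := by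
    intro n
    induction n with
    | zero => simp [statesOfLength, revWeight]
    | succ n ih =>
      refine le_trans ?_ ih
      rw [Finset.sum_range_succ, sum_statesOfLength_succ, add_assoc, ← Finset.sum_add_distrib]
      refine add_le_add le_rfl (Finset.sum_le_sum fun c _ => ?_)
      have := mul_le_mul_of_nonneg_left (hV c.toFinset) (hw c)
      rw [mul_add, mul_one, Finset.mul_sum] at this
      refine le_trans (add_le_add le_rfl (Finset.sum_le_sum fun i _ => ?_)) this
      rw [revWeight, List.toFinset_cons]
      exact le_of_eq (by ring)
  refine summable_of_sum_le (c := V ∅) hw fun u => ?_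
  set n := u.sup List.length + 1
  have hsub : u ⊆ (Finset.range n).biUnion (statesOfLength N) := fun c hc =>
    Finset.mem_biUnion.2 ⟨c.length, Finset.mem_range.2 (Nat.lt_succ_of_le
      (Finset.le_sup (f := List.length) hc)), mem_statesOfLength c⟩
  calc ∑ c ∈ u, Q.revWeight c
      ≤ ∑ c ∈ (Finset.range n).biUnion (statesOfLength N), Q.revWeight c :=
        Finset.sum_le_sum_of_subset_of_nonneg hsub fun c _ _ => hw c
    _ ≤ ∑ m ∈ Finset.range n, ∑ c ∈ statesOfLength N m, Q.revWeight c :=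
        (Finset.sum_biUnion fun m _ n _ hmn => Finset.disjoint_left.2 fun c hm hn =>
          hmn ((length_of_mem_statesOfLength hm).symm.trans (length_of_mem_statesOfLength hn))).le
    _ ≤ V ∅ := by
        have := Finset.sum_nonneg fun c (_ : c ∈ statesOfLength N n) =>
          mul_nonneg (hw c) (hV0 c.toFinset)
        linarith [hlevel n]

theorem IsSubcritical.isStable (h : Q.IsSubcritical) : Q.IsStable := by
  have hpos : ∀ c, 0 < Q.weight c := fun c => h.revWeight_pos _
  have hs : Summable Q.weight :=
    (Equiv.summable_iff (Function.Involutive.toPerm _ List.reverse_involutive)).2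
      h.summable_revWeight
  have hZ : 0 < ∑' c, Q.weight c := hs.tsum_pos (fun c => (hpos c).le) [] (hpos [])
  have hp : HasSum (fun c => Q.weight c / ∑' c, Q.weight c) 1 := by
    simpa only [div_self hZ.ne'] using hs.hasSum.div_const (∑' c, Q.weight c)
  have hpi : IsInvariantFor Q.jumpOperator fun c => Q.weight c / ∑' c, Q.weight c := fun d =>
    ((h.isInvariantFor_weight d).div_const (∑' c, Q.weight c)).of_eq (fun c => by ring) rfl
  have hP : Q.transitionProb = fun t c d =>
      poissonKernelOf Q.jumpOperator (Q.maxRate * t) c d := by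
    funext t c d
    exact Q.transitionProb_eq t c d
  rw [IsStable, hP]
  exact Q.isMarkovOperator_jumpOperator.isErgodicTransition
    (Q.jumpOperator_irreducible fun i => h.totalCapacity_pos (Finset.singleton_nonempty i))
    (fun c => div_pos (hpos c) hZ) hp hpi Q.maxRate_pos

end MultiServerQueue

theorem theorem1 {N S : ℕ} (Q : MultiServerQueue N S) :
    Q.IsStable ↔
      ∀ A : Finset (Fin N), A.Nonempty →
        ∑ i ∈ A, Q.arrivalRate i < Q.totalCapacity A :=
  ⟨fun h _ hA => h.sum_arrivalRate_lt hA, fun h => MultiServerQueue.IsSubcritical.isStable h⟩
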